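/- Let $H_R$ be the Connes–Kreimer Hopf algebra of rooted trees: the polynomial algebra over $\mathbb{C}$ in the generators $\phi^T$, one for each (isomorphism class of) finite rooted tree $T$, with the coproduct $\Delta$ that is the algebra homomorphism given by $$\Delta(\phi^T)=\phi^T\otimes 1+1\otimes\phi^T+\sum_{C}\phi^{P^C(T)}\otimes\phi^{R^C(T)},$$ where $C$ runs over the non-empty admissible cuts of $T$ (non-empty sets of edges with at most one edge on any path from the root downwards), $R^C(T)$ is the part that contains the root and $\phi^{P^C(T)}$ is the product of the generators of the branches cut off. Let $S$ be the antipode. Let $d$ be the exterior derivative on polynomial differential forms in the variables $\phi^T$, and for $a\in H_R$ let $\Pi_a=S(a_{(1)})\,d a_{(2)}$, where $\Delta(a)=a_{(1)}\otimes a_{(2)}$ (the left-invariant 1-form associated with $a$). Let $\Phi$ be the polynomial-degree operator, the linear operator on $H_R$ with $\Phi(\phi^{A_1}\cdots\phi^{A_r})=r\,\phi^{A_1}\cdots\phi^{A_r}$; it is invertible on the polynomials without constant term, and $\Phi^{-1}$ denotes its inverse there. Let $\phi'$ be a (finite) $\mathbb{C}$-linear combination of the generators $\phi^A$ such that $d\Pi_{\phi'}=0$.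 Then $S(\phi')$ has no constant term, and the element $$\psi'=-\Phi^{-1}\bigl(S(\phi')\bigr)$$ of $H_R$ is primitive, $\Delta(\psi')=\psi'\otimes 1+1\otimes\psi'$, and its linear part (the component of polynomial degree 1 in the $\phi$'s) is $\phi'$. -/

import Mathlib

open scoped TensorProduct

/-- A finite plane rooted tree: a root together with the finite sequence of the subtrees
that hang from its children. -/
inductive PlaneTree : Type
  | node (n : ℕ) (child : Fin n → PlaneTree) : PlaneTree

namespace PlaneTree

/-- Isomorphism of rooted trees: the subtrees at the children of the roots are matched by a
bijection, up to isomorphism. -/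
inductive Iso : PlaneTree → PlaneTree → Prop
  | node {m n : ℕ} {f : Fin m → PlaneTree} {g : Fin n → PlaneTree} (σ : Fin m ≃ Fin n)
      (h : ∀ i, Iso (f i) (g (σ i))) : Iso (PlaneTree.node m f) (PlaneTree.node n g)

theorem Iso.refl (t : PlaneTree) : Iso t t := by
  induction t with
  | node n f ih => exact Iso.node (Equiv.refl _) ih

theorem Iso.symm {s t : PlaneTree} (h : Iso s t) : Iso t s := by
  induction h with
  | node σ _ ih =>
    exact Iso.node σ.symm fun i => by simpa using ih (σ.symm i)

theorem Iso.trans {s t u : PlaneTree} (h : Iso s t) (h' : Iso t u) : Iso s u := by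
  induction h generalizing u with
  | node σ _ ih =>
    cases h' with
    | node τ k => exact Iso.node (σ.trans τ) fun i => ih i (k (σ i))

instance setoid : Setoid PlaneTree where
  r := Iso
  iseqv := ⟨Iso.refl, Iso.symm, Iso.trans⟩

/-- The tree whose root has the given trees hanging from it. -/
def ofList (l : List PlaneTree) : PlaneTree := node l.length l.get

/-- An admissible cut of a tree, in the sense that includes the full and the empty cut.
Either the whole tree is cut off above its root (`full`), or the root stays and an admissible cut
is chosen, independently, in the subtree at each child of the root (`keepRoot`). The full cut of
such a subtree is the simple cut of the edge that joins it to the root, so that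
exactly the sets of edges with at most one edge on each path from the root downwards arise,
together with the full cut of the whole tree; each arises once. -/
inductive Cut : PlaneTree → Type
  | full (t : PlaneTree) : Cut t
  | keepRoot {n : ℕ} {f : Fin n → PlaneTree} (c : ∀ i, Cut (f i)) : Cut (node n f)

namespace Cut

/-- The branches that the cut `c` removes. -/
def pruned : {t : PlaneTree} → Cut t → Multiset PlaneTree
  | _, full t => {t}
  | _, keepRoot c => ∑ i, pruned (c i)

/-- The part that the cut `c` leaves, which contains the root; `none` if nothing is left. -/
def trunk : {t : PlaneTree} → Cut t → Option PlaneTree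
  | _, full _ => none
  | _, keepRoot c => some (ofList (List.ofFn fun i => trunk (c i)).reduceOption)

/-- A cut of a tree is the full cut, or a family of cuts of the subtrees at the children. -/
def equivOption {n : ℕ} (f : Fin n → PlaneTree) :
    Cut (node n f) ≃ Option (∀ i, Cut (f i)) where
  toFun c := match c with
    | full _ => none
    | keepRoot c => some c
  invFun o := match o with
    | none => full _
    | some c => keepRoot c
  left_inv c := by cases c <;> rfl
  right_inv o := by cases o <;> rfl

noncomputable instance fintype : (t : PlaneTree) → Fintype (Cut t)
  | node _ f =>
    letI : ∀ i, Fintype (Cut (f i)) := fun i => fintype (f i)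
    Fintype.ofEquiv _ (equivOption f).symm

end Cut

end PlaneTree

/-- Rooted trees, that is, isomorphism classes of finite rooted trees. -/
def RTree : Type := Quotient PlaneTree.setoid

/-- The isomorphism class of a plane rooted tree. -/
def PlaneTree.toRooted (t : PlaneTree) : RTree := Quotient.mk _ t

/-- A plane representative of a rooted tree. -/
noncomputable def RTree.rep (T : RTree) : PlaneTree := Quotient.out (s := PlaneTree.setoid) T

theorem RTree.toRooted_rep (T : RTree) : T.rep.toRooted = T := Quotient.out_eq _

theorem PlaneTree.iso_rep (t : PlaneTree) : t.toRooted.rep.Iso t :=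
  Quotient.mk_out (s := PlaneTree.setoid) t

/-- The commutative algebra of rooted trees: polynomials over `ℂ` in the generators
`φ^T = X T`, where `T` ranges over the rooted trees. -/
abbrev HR : Type := MvPolynomial RTree ℂ

namespace HR

open PlaneTree

/-- The generator `φ^T` that belongs to the isomorphism class of `t`. -/
noncomputable def gen (t : PlaneTree) : HR := MvPolynomial.X t.toRooted

/-- The coproduct of a generator: the sum over all admissible cuts, the full and the empty cut
included, of (product of the branches cut off) ⊗ (part left at the root). -/
noncomputable def comulTree (t : PlaneTree) : HR ⊗[ℂ] HR :=
  ∑ c : Cut t, (c.pruned.map gen).prod ⊗ₜ[ℂ] c.trunk.elim 1 gen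

theorem gen_eq_of_iso {s t : PlaneTree} (h : Iso s t) : gen s = gen t :=
  congrArg MvPolynomial.X (Quotient.sound h)

theorem exists_eq_gen (T : RTree) : ∃ t : PlaneTree, MvPolynomial.X T = gen t :=
  ⟨T.rep, by rw [gen, T.toRooted_rep]⟩

theorem iso_ofList_of_forall₂ {l l' : List PlaneTree} (h : List.Forall₂ Iso l l') :
    Iso (ofList l) (ofList l') := by
  refine Iso.node (finCongr h.length_eq) fun i => ?_
  simpa using h.get i.2 (h.length_eq ▸ i.2)

theorem exists_equiv_of_perm {l l' : List PlaneTree} (h : l.Perm l') :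
    ∃ σ : Fin l.length ≃ Fin l'.length, ∀ i, l.get i = l'.get (σ i) := by
  induction h with
  | nil => exact ⟨Equiv.refl _, fun _ => rfl⟩
  | @cons a l l' _ ih =>
    obtain ⟨σ, hσ⟩ := ih
    refine ⟨(finSuccEquiv l.length).trans ((Equiv.optionCongr σ).trans
      (finSuccEquiv l'.length).symm), fun i => ?_⟩
    refine Fin.cases ?_ (fun i => ?_) i
    · simp
    · simpa using hσ i
  | swap a b l =>
    refine ⟨Equiv.swap (0 : Fin (l.length + 2)) 1, fun i => ?_⟩
    refine Fin.cases ?_ (fun i => Fin.cases ?_ (fun i => ?_) i) i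
    · simp
    · simp
    · rw [Equiv.swap_apply_of_ne_of_ne (by simp) (by simp [Fin.ext_iff])]
      simp
  | trans _ _ ih₁ ih₂ =>
    obtain ⟨σ, hσ⟩ := ih₁
    obtain ⟨τ, hτ⟩ := ih₂
    exact ⟨σ.trans τ, fun i => (hσ i).trans (hτ (σ i))⟩

theorem iso_ofList_of_perm {l l' : List PlaneTree} (h : l.Perm l') :
    Iso (ofList l) (ofList l') := by
  obtain ⟨σ, hσ⟩ := exists_equiv_of_perm h
  exact Iso.node σ fun i => hσ i ▸ Iso.refl _

/-- The rooted tree obtained by joining the members of a forest to a new root. -/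
noncomputable def graft (F : Multiset RTree) : RTree :=
  (ofList (F.map RTree.rep).toList).toRooted

theorem graft_coe (l : List PlaneTree) :
    graft (l.map toRooted : List RTree) = (ofList l).toRooted := by
  refine Quotient.sound ?_
  refine Iso.trans (iso_ofList_of_perm (l' := (l.map toRooted).map RTree.rep) ?_)
    (iso_ofList_of_forall₂ ?_)
  · rw [← Multiset.coe_eq_coe, Multiset.coe_toList]; rfl
  · rw [List.map_map, List.forall₂_map_left_iff, List.forall₂_same]
    exact fun t _ => t.iso_rep

/-- The linear operator that joins all trees of a monomial to a new root. -/
noncomputable def joinRoot : HR →ₗ[ℂ] HR :=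
  (MvPolynomial.basisMonomials RTree ℂ).constr ℂ fun m =>
    MvPolynomial.X (graft (Finsupp.toMultiset m))

open Classical in
theorem list_prod_gen (l : List PlaneTree) :
    (l.map gen).prod =
      MvPolynomial.monomial (Multiset.toFinsupp (l.map toRooted : List RTree)) (1 : ℂ) := by
  induction l with
  | nil => simp
  | cons t l ih =>
    rw [List.map_cons, List.prod_cons, ih, gen, List.map_cons, ← Multiset.cons_coe,
      ← Multiset.singleton_add (toRooted t), map_add, Multiset.toFinsupp_singleton,
      MvPolynomial.X, MvPolynomial.monomial_mul, one_mul]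

open Classical in
theorem joinRoot_list (l : List PlaneTree) : joinRoot (l.map gen).prod = gen (ofList l) := by
  rw [list_prod_gen]
  have := (MvPolynomial.basisMonomials RTree ℂ).constr_basis ℂ
    (fun m => (MvPolynomial.X (graft (Finsupp.toMultiset m)) : HR))
    (Multiset.toFinsupp (l.map toRooted : List RTree))
  rw [MvPolynomial.coe_basisMonomials] at this
  rw [joinRoot, this, Multiset.toFinsupp_toMultiset, graft_coe, gen]

theorem joinRoot_prod {n : ℕ} (f : Fin n → PlaneTree) :
    joinRoot (∏ i, gen (f i)) = gen (node n f) := by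
  have : ∏ i, gen (f i) = ((List.ofFn f).map gen).prod := by
    rw [List.map_ofFn, List.prod_ofFn]; rfl
  rw [this, joinRoot_list]
  refine gen_eq_of_iso (Iso.node (finCongr (by simp)) fun i => ?_)
  simpa [Fin.cast] using Iso.refl _

open Classical in
theorem exists_list (m : RTree →₀ ℕ) :
    ∃ l : List PlaneTree, MvPolynomial.monomial m (1 : ℂ) = (l.map gen).prod := by
  refine ⟨(Finsupp.toMultiset m).toList.map RTree.rep, ?_⟩
  rw [list_prod_gen]
  simp [Function.comp_def, RTree.toRooted_rep]

theorem list_prod_trunk {n : ℕ} (o : Fin n → Option PlaneTree) :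
    (((List.ofFn o).reduceOption).map gen).prod = ∏ i, (o i).elim 1 gen := by
  rw [← List.prod_ofFn, ← Function.comp_def (fun x : Option PlaneTree => x.elim 1 gen) o,
    ← List.map_ofFn]
  generalize List.ofFn o = l
  induction l with
  | nil => rfl
  | cons a l ih => cases a <;> simp [ih]

theorem prod_tmul {ι : Type} (s : Finset ι) (a b : ι → HR) :
    ∏ i ∈ s, a i ⊗ₜ[ℂ] b i = (∏ i ∈ s, a i) ⊗ₜ[ℂ] (∏ i ∈ s, b i) := by
  classical
  induction s using Finset.induction_on with
  | empty => rfl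
  | insert i s hi ih => simp [Finset.prod_insert hi, ih]

theorem multiset_prod_map_sum {ι : Type} (s : Finset ι) (F : ι → Multiset PlaneTree) :
    ((∑ i ∈ s, F i).map gen).prod = ∏ i ∈ s, ((F i).map gen).prod := by
  classical
  induction s using Finset.induction_on with
  | empty => simp
  | insert i s hi ih => simp [Finset.sum_insert hi, Finset.prod_insert hi, ih]

theorem comulTree_node {n : ℕ} (f : Fin n → PlaneTree) :
    comulTree (node n f) = gen (node n f) ⊗ₜ[ℂ] 1 +
      joinRoot.lTensor HR (∏ i, comulTree (f i)) := by
  classical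
  rw [comulTree, ← Equiv.sum_comp (Cut.equivOption f).symm, Fintype.sum_option]
  congr 1
  · change (Multiset.map gen {node n f}).prod ⊗ₜ[ℂ] (1 : HR) = _
    simp
  · simp only [comulTree]
    rw [Finset.prod_univ_sum, Fintype.piFinset_univ, map_sum]
    refine Finset.sum_congr rfl fun c _ => ?_
    rw [prod_tmul, LinearMap.lTensor_tmul, ← list_prod_trunk, joinRoot_list,
      ← multiset_prod_map_sum]
    rfl

theorem comulTree_eq_of_iso {s t : PlaneTree} (h : Iso s t) : comulTree s = comulTree t := by
  induction h with
  | @node m n f g σ h ih =>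
    rw [comulTree_node, comulTree_node, gen_eq_of_iso (Iso.node σ h), ← Equiv.prod_comp σ]
    simp only [ih]

/-- The coproduct of the generator `φ^T`. -/
noncomputable def comulGen (T : RTree) : HR ⊗[ℂ] HR :=
  Quotient.lift comulTree (fun _ _ h => comulTree_eq_of_iso h) T

/-- The coproduct `Δ`, the algebra homomorphism that is given on generators by the sum over all
admissible cuts. -/
noncomputable def comulHom : HR →ₐ[ℂ] HR ⊗[ℂ] HR :=
  MvPolynomial.aeval comulGen

theorem comulHom_gen (t : PlaneTree) : comulHom (gen t) = comulTree t := by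
  rw [comulHom, gen, MvPolynomial.aeval_X]; rfl

theorem comulHom_joinRoot (x : HR) :
    comulHom (joinRoot x) = joinRoot x ⊗ₜ[ℂ] 1 + joinRoot.lTensor HR (comulHom x) := by
  suffices h : comulHom.toLinearMap ∘ₗ joinRoot =
      (Algebra.TensorProduct.includeLeft (R := ℂ) (S := ℂ) (A := HR) (B := HR)).toLinearMap ∘ₗ
        joinRoot + joinRoot.lTensor HR ∘ₗ comulHom.toLinearMap from LinearMap.congr_fun h x
  refine (MvPolynomial.basisMonomials RTree ℂ).ext fun m => ?_
  obtain ⟨l, hl⟩ := exists_list m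
  rw [MvPolynomial.coe_basisMonomials]
  beta_reduce
  rw [hl]
  change comulHom (joinRoot (l.map gen).prod) =
    joinRoot (l.map gen).prod ⊗ₜ[ℂ] 1 + joinRoot.lTensor HR (comulHom (l.map gen).prod)
  rw [joinRoot_list, comulHom_gen, ofList, comulTree_node, map_list_prod, List.map_map]
  congr 2
  rw [← List.prod_ofFn]
  congr 1
  refine List.ext_get (by simp) fun i h₁ h₂ => ?_
  simp [comulHom_gen]

/-- Every generator arises from smaller ones through `joinRoot`. -/
theorem algHom_ext_joinRoot {B : Type} [CommSemiring B] [Algebra ℂ B] {F G : HR →ₐ[ℂ] B}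
    (h : ∀ x, F x = G x → F (joinRoot x) = G (joinRoot x)) : F = G := by
  have key : ∀ t : PlaneTree, F (gen t) = G (gen t) := by
    intro t
    induction t with
    | node n f ih =>
      rw [← joinRoot_prod]
      refine h _ ?_
      simp only [map_prod, ih]
  refine MvPolynomial.algHom_ext fun T => ?_
  obtain ⟨t, ht⟩ := exists_eq_gen T
  rw [ht, key]

/-- The counit: evaluation at the identity of the group, where all generators vanish. -/
noncomputable def counitHom : HR →ₐ[ℂ] ℂ := MvPolynomial.aeval 0

theorem counitHom_gen (t : PlaneTree) : counitHom (gen t) = 0 := by simp [counitHom, gen]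

theorem counitHom_joinRoot (x : HR) : counitHom (joinRoot x) = 0 := by
  suffices h : counitHom.toLinearMap ∘ₗ joinRoot = 0 from LinearMap.congr_fun h x
  refine (MvPolynomial.basisMonomials RTree ℂ).ext fun m => ?_
  obtain ⟨l, hl⟩ := exists_list m
  rw [MvPolynomial.coe_basisMonomials]
  beta_reduce
  rw [hl]
  change counitHom (joinRoot (l.map gen).prod) = 0
  rw [joinRoot_list, counitHom_gen]

theorem coassoc_aux (y : HR ⊗[ℂ] HR) :
    Algebra.TensorProduct.assoc ℂ ℂ ℂ HR HR HR
        (Algebra.TensorProduct.map comulHom (.id ℂ HR) (joinRoot.lTensor HR y)) =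
      (joinRoot.lTensor HR).lTensor HR (Algebra.TensorProduct.assoc ℂ ℂ ℂ HR HR HR
        (Algebra.TensorProduct.map comulHom (.id ℂ HR) y)) := by
  induction y using TensorProduct.induction_on with
  | zero => simp
  | add y z hy hz => simp only [map_add, hy, hz]
  | tmul a b =>
    simp only [LinearMap.lTensor_tmul, Algebra.TensorProduct.map_tmul, AlgHom.id_apply]
    generalize comulHom a = w
    induction w using TensorProduct.induction_on with
    | zero => simp
    | add y z hy hz => simp only [TensorProduct.add_tmul, map_add, hy, hz]
    | tmul a' b' => simp

theorem coassoc_aux' (y : HR ⊗[ℂ] HR) :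
    Algebra.TensorProduct.map (.id ℂ HR) comulHom (joinRoot.lTensor HR y) =
      Algebra.TensorProduct.assoc ℂ ℂ ℂ HR HR HR (joinRoot.lTensor HR y ⊗ₜ[ℂ] 1) +
      (joinRoot.lTensor HR).lTensor HR
        (Algebra.TensorProduct.map (.id ℂ HR) comulHom y) := by
  induction y using TensorProduct.induction_on with
  | zero => simp
  | add y z hy hz =>
    simp only [map_add, hy, hz, TensorProduct.add_tmul]
    abel
  | tmul a b =>
    simp only [LinearMap.lTensor_tmul, Algebra.TensorProduct.map_tmul, AlgHom.id_apply,
      comulHom_joinRoot, TensorProduct.tmul_add]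
    rfl

theorem coassoc : (Algebra.TensorProduct.assoc ℂ ℂ ℂ HR HR HR).toAlgHom.comp
      ((Algebra.TensorProduct.map comulHom (.id ℂ HR)).comp comulHom) =
    (Algebra.TensorProduct.map (.id ℂ HR) comulHom).comp comulHom := by
  refine algHom_ext_joinRoot (B := HR ⊗[ℂ] (HR ⊗[ℂ] HR)) fun x hx => ?_
  change Algebra.TensorProduct.assoc ℂ ℂ ℂ HR HR HR
    (Algebra.TensorProduct.map comulHom (.id ℂ HR) (comulHom x)) =
    Algebra.TensorProduct.map (.id ℂ HR) comulHom (comulHom x) at hx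
  change Algebra.TensorProduct.assoc ℂ ℂ ℂ HR HR HR
    (Algebra.TensorProduct.map comulHom (.id ℂ HR) (comulHom (joinRoot x))) =
    Algebra.TensorProduct.map (.id ℂ HR) comulHom (comulHom (joinRoot x))
  rw [comulHom_joinRoot, map_add, map_add, map_add, coassoc_aux, coassoc_aux', hx, ← add_assoc]
  congr 1
  rw [Algebra.TensorProduct.map_tmul, Algebra.TensorProduct.map_tmul, comulHom_joinRoot,
    TensorProduct.add_tmul, map_add, map_one, map_one]
  rfl

theorem rTensor_counit_aux (y : HR ⊗[ℂ] HR) :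
    Algebra.TensorProduct.map counitHom (.id ℂ HR) (joinRoot.lTensor HR y) =
      joinRoot.lTensor ℂ (Algebra.TensorProduct.map counitHom (.id ℂ HR) y) := by
  induction y using TensorProduct.induction_on with
  | zero => simp
  | add y z hy hz => simp only [map_add, hy, hz]
  | tmul a b => simp

theorem rTensor_counit : (Algebra.TensorProduct.map counitHom (.id ℂ HR)).comp comulHom =
    (Algebra.TensorProduct.lid ℂ HR).symm := by
  refine algHom_ext_joinRoot fun x hx => ?_
  change Algebra.TensorProduct.map counitHom (.id ℂ HR) (comulHom x) = 1 ⊗ₜ[ℂ] x at hx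
  change Algebra.TensorProduct.map counitHom (.id ℂ HR) (comulHom (joinRoot x)) =
    1 ⊗ₜ[ℂ] joinRoot x
  rw [comulHom_joinRoot, map_add, rTensor_counit_aux, hx, Algebra.TensorProduct.map_tmul,
    counitHom_joinRoot, TensorProduct.zero_tmul, zero_add, LinearMap.lTensor_tmul]

theorem lTensor_counit_aux (y : HR ⊗[ℂ] HR) :
    Algebra.TensorProduct.map (.id ℂ HR) counitHom (joinRoot.lTensor HR y) = 0 := by
  induction y using TensorProduct.induction_on with
  | zero => simp
  | add y z hy hz => simp only [map_add, hy, hz, add_zero]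
  | tmul a b => simp [counitHom_joinRoot]

theorem lTensor_counit : (Algebra.TensorProduct.map (.id ℂ HR) counitHom).comp comulHom =
    (Algebra.TensorProduct.rid ℂ ℂ HR).symm := by
  refine algHom_ext_joinRoot fun x _ => ?_
  change Algebra.TensorProduct.map (.id ℂ HR) counitHom (comulHom (joinRoot x)) =
    joinRoot x ⊗ₜ[ℂ] 1
  rw [comulHom_joinRoot, map_add, lTensor_counit_aux, add_zero, Algebra.TensorProduct.map_tmul,
    map_one, AlgHom.id_apply]

/-- The image of the coproduct of `φ^t` under `S ⊗ id`, by recursion on `t`. -/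
noncomputable def antipodeAux : PlaneTree → HR ⊗[ℂ] HR
  | node _ f =>
    joinRoot.lTensor HR (∏ i, antipodeAux (f i)) -
      Algebra.TensorProduct.lmul' ℂ (joinRoot.lTensor HR (∏ i, antipodeAux (f i))) ⊗ₜ[ℂ] 1

/-- The antipode of `φ^t`: the solution `S(φ^t)` of `S(φ^t) + ∑ S(φ^P) φ^R = 0`, where the sum is
over all admissible cuts but the full one. -/
noncomputable def antipodeTree : PlaneTree → HR
  | node _ f => -Algebra.TensorProduct.lmul' ℂ (joinRoot.lTensor HR (∏ i, antipodeAux (f i)))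

theorem antipodeAux_eq_of_iso {s t : PlaneTree} (h : Iso s t) :
    antipodeAux s = antipodeAux t := by
  induction h with
  | @node m n f g σ h ih =>
    rw [antipodeAux, antipodeAux, ← Equiv.prod_comp σ (fun i => antipodeAux (g i))]
    simp only [ih]

theorem antipodeTree_eq_of_iso {s t : PlaneTree} (h : Iso s t) :
    antipodeTree s = antipodeTree t := by
  cases h with
  | @node m n f g σ h =>
    rw [antipodeTree, antipodeTree, ← Equiv.prod_comp σ (fun i => antipodeAux (g i))]
    simp only [antipodeAux_eq_of_iso (h _)]

/-- The antipode of the generator `φ^T`. -/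
noncomputable def antipodeGen (T : RTree) : HR :=
  Quotient.lift antipodeTree (fun _ _ h => antipodeTree_eq_of_iso h) T

/-- The antipode `S`. -/
noncomputable def antipodeHom : HR →ₐ[ℂ] HR := MvPolynomial.aeval antipodeGen

theorem antipodeHom_gen (t : PlaneTree) : antipodeHom (gen t) = antipodeTree t := by
  rw [antipodeHom, gen, MvPolynomial.aeval_X]; rfl

theorem map_lTensor_joinRoot (F : HR →ₐ[ℂ] HR) (y : HR ⊗[ℂ] HR) :
    Algebra.TensorProduct.map F (.id ℂ HR) (joinRoot.lTensor HR y) =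
      joinRoot.lTensor HR (Algebra.TensorProduct.map F (.id ℂ HR) y) := by
  induction y using TensorProduct.induction_on with
  | zero => simp
  | add y z hy hz => simp only [map_add, hy, hz]
  | tmul a b => simp

theorem map_antipodeHom_comulTree (t : PlaneTree) :
    Algebra.TensorProduct.map antipodeHom (.id ℂ HR) (comulTree t) = antipodeAux t := by
  induction t with
  | node n f ih =>
    rw [comulTree_node, map_add, map_lTensor_joinRoot, map_prod, Algebra.TensorProduct.map_tmul,
      antipodeHom_gen, map_one, antipodeTree, antipodeAux]
    simp only [ih]
    rw [TensorProduct.neg_tmul]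
    abel

theorem antipode_mul_id : (Algebra.TensorProduct.lmul' ℂ (S := HR)).comp
      ((Algebra.TensorProduct.map antipodeHom (.id ℂ HR)).comp comulHom) =
    (Algebra.ofId ℂ HR).comp counitHom := by
  refine MvPolynomial.algHom_ext fun T => ?_
  obtain ⟨t, ht⟩ := exists_eq_gen T
  rw [ht]
  change Algebra.TensorProduct.lmul' ℂ
    (Algebra.TensorProduct.map antipodeHom (.id ℂ HR) (comulHom (gen t))) =
    algebraMap ℂ HR (counitHom (gen t))
  rw [comulHom_gen, map_antipodeHom_comulTree, counitHom_gen, map_zero]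
  cases t with
  | node n f => rw [antipodeAux, map_sub, Algebra.TensorProduct.lmul'_apply_tmul, mul_one, sub_self]

/-- The convolution product of the identity and the antipode. -/
noncomputable def idMulAntipode : HR →ₐ[ℂ] HR :=
  (Algebra.TensorProduct.lmul' ℂ (S := HR)).comp
    ((Algebra.TensorProduct.map (.id ℂ HR) antipodeHom).comp comulHom)

theorem idMulAntipode_mul_id (x : HR) : Algebra.TensorProduct.lmul' ℂ
    (Algebra.TensorProduct.map idMulAntipode (.id ℂ HR) (comulHom x)) = x := by
  let M : HR ⊗[ℂ] (HR ⊗[ℂ] HR) →ₐ[ℂ] HR := (Algebra.TensorProduct.lmul' ℂ (S := HR)).comp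
    (Algebra.TensorProduct.map (.id ℂ HR) ((Algebra.TensorProduct.lmul' ℂ (S := HR)).comp
      (Algebra.TensorProduct.map antipodeHom (.id ℂ HR))))
  have h₁ : ∀ y : HR ⊗[ℂ] HR, Algebra.TensorProduct.lmul' ℂ
      (Algebra.TensorProduct.map idMulAntipode (.id ℂ HR) y) =
      M (Algebra.TensorProduct.assoc ℂ ℂ ℂ HR HR HR
        (Algebra.TensorProduct.map comulHom (.id ℂ HR) y)) := by
    intro y
    induction y using TensorProduct.induction_on with
    | zero => simp
    | add y z hy hz => simp only [map_add, hy, hz]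
    | tmul a b =>
      rw [Algebra.TensorProduct.map_tmul, Algebra.TensorProduct.map_tmul, idMulAntipode]
      change Algebra.TensorProduct.lmul' ℂ (Algebra.TensorProduct.lmul' ℂ
        (Algebra.TensorProduct.map (.id ℂ HR) antipodeHom (comulHom a)) ⊗ₜ[ℂ] b) = _
      generalize comulHom a = w
      induction w using TensorProduct.induction_on with
      | zero => simp
      | add y z hy hz => simp only [TensorProduct.add_tmul, map_add, hy, hz]
      | tmul a' b' => simp [M, mul_assoc]
  have h₂ : ∀ y : HR ⊗[ℂ] HR, M (Algebra.TensorProduct.map (.id ℂ HR) comulHom y) =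
      Algebra.TensorProduct.rid ℂ ℂ HR (Algebra.TensorProduct.map (.id ℂ HR) counitHom y) := by
    intro y
    induction y using TensorProduct.induction_on with
    | zero => simp
    | add y z hy hz => simp only [map_add, hy, hz]
    | tmul a b =>
      have := AlgHom.congr_fun antipode_mul_id b
      simp only [AlgHom.comp_apply] at this
      simp [M, this, Algebra.ofId_apply, Algebra.smul_def, mul_comm]
  have h₃ := AlgHom.congr_fun coassoc x
  have h₄ := AlgHom.congr_fun lTensor_counit x
  simp only [AlgHom.comp_apply] at h₃ h₄
  rw [h₁]
  refine (congrArg M h₃).trans ((h₂ _).trans ((congrArg _ h₄).trans ?_))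
  simp

theorem id_mul_antipode : idMulAntipode = (Algebra.ofId ℂ HR).comp counitHom := by
  have key : ∀ t : PlaneTree, idMulAntipode (gen t) = 0 ∧
      Algebra.TensorProduct.map idMulAntipode (.id ℂ HR) (comulTree t) = 1 ⊗ₜ[ℂ] gen t := by
    intro t
    induction t with
    | node n f ih =>
      have h : Algebra.TensorProduct.map idMulAntipode (.id ℂ HR) (comulTree (node n f)) =
          idMulAntipode (gen (node n f)) ⊗ₜ[ℂ] 1 + 1 ⊗ₜ[ℂ] gen (node n f) := by
        rw [comulTree_node, map_add, map_lTensor_joinRoot, map_prod,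
          Algebra.TensorProduct.map_tmul, map_one]
        simp only [fun i => (ih i).2]
        rw [prod_tmul, Finset.prod_const_one, LinearMap.lTensor_tmul, joinRoot_prod]
      have h₀ : idMulAntipode (gen (node n f)) = 0 := by
        have := idMulAntipode_mul_id (gen (node n f))
        rw [comulHom_gen, h] at this
        simpa using this
      exact ⟨h₀, by rw [h, h₀, TensorProduct.zero_tmul, zero_add]⟩
  refine MvPolynomial.algHom_ext fun T => ?_
  obtain ⟨t, ht⟩ := exists_eq_gen T
  rw [ht, (key t).1, AlgHom.comp_apply, counitHom_gen, map_zero]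

/-- The Hopf algebra of rooted trees: `comulHom`, `counitHom` and `antipodeHom` satisfy all axioms
of a Hopf algebra. This is not an instance, because Mathlib equips `MvPolynomial` with another
coalgebra structure, in which the monomials are group-like. -/
@[reducible]
noncomputable def hopfAlgebra : HopfAlgebra ℂ HR :=
  letI B : Bialgebra ℂ HR :=
    Bialgebra.ofAlgHom comulHom counitHom coassoc rTensor_counit lTensor_counit
  { B with
    antipode := antipodeHom.toLinearMap
    mul_antipode_rTensor_comul := congrArg AlgHom.toLinearMap antipode_mul_id
    mul_antipode_lTensor_comul := congrArg AlgHom.toLinearMap id_mul_antipode }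

theorem hopfAlgebra_comul : hopfAlgebra.comul = comulHom.toLinearMap := rfl

theorem hopfAlgebra_counit : hopfAlgebra.counit = counitHom.toLinearMap := rfl

theorem hopfAlgebra_antipode : hopfAlgebra.antipode = antipodeHom.toLinearMap := rfl

/-- The space `A₁`: the linear combinations of the generators `φ^T`. -/
noncomputable def linearSpan : Submodule ℂ HR := Submodule.span ℂ (Set.range MvPolynomial.X)

/-- An element `a` is primitive when `Δ a = a ⊗ 1 + 1 ⊗ a`. -/
def IsPrimitive (a : HR) : Prop :=
  comulHom a = a ⊗ₜ[ℂ] 1 + 1 ⊗ₜ[ℂ] a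

/-- The exterior derivative of a 1-form `ω = ∑ ω_T dφ^T`, the 2-form `∑ dω_T ∧ dφ^T`.
The 1-forms are the Kähler differentials of the polynomial algebra, which are free on the
`dφ^T`, and the 2-forms are their exterior square. -/
noncomputable def extDeriv (ω : Ω[HR⁄ℂ]) : ⋀[HR]^2 Ω[HR⁄ℂ] :=
  ((KaehlerDifferential.mvPolynomialBasis ℂ RTree).repr ω).sum fun T a =>
    exteriorPower.ιMulti HR 2
      ![KaehlerDifferential.D ℂ HR a, KaehlerDifferential.D ℂ HR (MvPolynomial.X T)]

/-- The linear map `a ⊗ b ↦ S(a) db`. -/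
noncomputable def antipodeSmulD : HR ⊗[ℂ] HR →ₗ[ℂ] Ω[HR⁄ℂ] :=
  TensorProduct.lift
    (LinearMap.mk₂ ℂ (fun a b : HR => antipodeHom a • KaehlerDifferential.D ℂ HR b)
      (fun a a' b => by rw [map_add, add_smul])
      (fun c a b => by rw [map_smul, smul_assoc])
      (fun a b b' => by rw [map_add, smul_add])
      (fun c a b => by rw [Derivation.map_smul, smul_comm]))

/-- The left-invariant 1-form `Π_a = S(a₍₁₎) da₍₂₎`. -/
noncomputable def leftInvariantForm (a : HR) : Ω[HR⁄ℂ] :=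
  antipodeSmulD (comulHom a)

/-- The polynomial degree operator `Φ`: multiplication by `r` on each monomial
`φ^{A₁} ⋯ φ^{Aᵣ}`. -/
noncomputable def pDegree : HR →ₗ[ℂ] HR :=
  (MvPolynomial.basisMonomials RTree ℂ).constr ℂ fun m =>
    (m.degree : ℂ) • MvPolynomial.monomial m 1

/-- The operator `Φ⁻¹`: division by `r` on each monomial `φ^{A₁} ⋯ φ^{Aᵣ}` with `r ≥ 1`. It inverts
`Φ` on the polynomials without constant term, where `Φ` is invertible; constants go to `0`. -/
noncomputable def pDegreeInv : HR →ₗ[ℂ] HR :=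
  (MvPolynomial.basisMonomials RTree ℂ).constr ℂ fun m =>
    (m.degree : ℂ)⁻¹ • MvPolynomial.monomial m 1

theorem pDegree_monomial (m : RTree →₀ ℕ) (c : ℂ) :
    pDegree (MvPolynomial.monomial m c) = MvPolynomial.monomial m ((m.degree : ℂ) * c) := by
  have h := (MvPolynomial.basisMonomials RTree ℂ).constr_basis ℂ
    (fun m => (m.degree : ℂ) • (MvPolynomial.monomial m 1 : HR)) m
  rw [MvPolynomial.coe_basisMonomials] at h
  have : (MvPolynomial.monomial m c : HR) = c • MvPolynomial.monomial m 1 := by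
    rw [MvPolynomial.smul_monomial, smul_eq_mul, mul_one]
  rw [this, map_smul, pDegree, h]
  rw [MvPolynomial.smul_monomial, MvPolynomial.smul_monomial, smul_eq_mul, smul_eq_mul, mul_one,
    mul_comm]

theorem pDegreeInv_monomial (m : RTree →₀ ℕ) (c : ℂ) :
    pDegreeInv (MvPolynomial.monomial m c) = MvPolynomial.monomial m ((m.degree : ℂ)⁻¹ * c) := by
  have h := (MvPolynomial.basisMonomials RTree ℂ).constr_basis ℂ
    (fun m => (m.degree : ℂ)⁻¹ • (MvPolynomial.monomial m 1 : HR)) m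
  rw [MvPolynomial.coe_basisMonomials] at h
  have : (MvPolynomial.monomial m c : HR) = c • MvPolynomial.monomial m 1 := by
    rw [MvPolynomial.smul_monomial, smul_eq_mul, mul_one]
  rw [this, map_smul, pDegreeInv, h]
  rw [MvPolynomial.smul_monomial, MvPolynomial.smul_monomial, smul_eq_mul, smul_eq_mul, mul_one,
    mul_comm]

theorem pDegree_comm (a : HR) : pDegreeInv (pDegree a) = pDegree (pDegreeInv a) := by
  induction a using MvPolynomial.induction_on' with
  | monomial m c => simp only [pDegree_monomial, pDegreeInv_monomial, mul_left_comm]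
  | add p q hp hq => simp only [map_add, hp, hq]

open Classical in
theorem pDegree_pDegreeInv (a : HR) :
    pDegree (pDegreeInv a) = a - MvPolynomial.C (MvPolynomial.constantCoeff a) := by
  induction a using MvPolynomial.induction_on' with
  | monomial m c =>
    rw [pDegreeInv_monomial, pDegree_monomial]
    by_cases hm : m = 0
    · subst hm; simp
    · have : (m.degree : ℂ) ≠ 0 := by simpa [Finsupp.degree_eq_zero_iff] using hm
      have h₀ : MvPolynomial.constantCoeff (MvPolynomial.monomial m c : HR) = 0 := by
        rw [MvPolynomial.constantCoeff_eq, MvPolynomial.coeff_monomial, if_neg hm]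
      rw [mul_inv_cancel_left₀ this, h₀, map_zero, sub_zero]
  | add p q hp hq =>
    simp only [map_add, hp, hq]
    ring

end HR

/-!
The closed form `Π_a` of a linear `a` is exact, and its potential vanishing at the origin is
`ψ = -Φ⁻¹(S a)`; left invariance of `Π_a` then makes `ψ` primitive.

Exactness is the Poincaré lemma with the Euler field `E`, the derivation `Φ`. For a closed 1-form
`ω`, Cartan's formula gives `d(i_E ω) = L_E ω` (`pderiv_contractEuler`), and on the coefficients of
`ω` the Lie derivative `L_E` is `Φ + 1`, which is injective; so `Φ ψ = i_E ω` with `ω` closed forces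
`dψ = ω` (`D_eq_of_closed`). For `ω = Π_a` the contraction is `S(a₍₁₎) Φ(a₍₂₎)`, and this is `-S(a)`
when `a` is linear (`antipode_conv_pDegree`).

For primitivity, `dψ = S(a₍₁₎) da₍₂₎` evaluates every derivation along every algebra homomorphism at
`ψ` (`apply_eq_conv_of_D_eq`). For the derivation `(id ⊗ Φ) ∘ Δ` along `Δ`, the value is
`1 ⊗ S(a₍₁₎) Φ(a₍₂₎)` by a computation in the convolution algebra (`antipode_conv_lTensor`), which
expresses that `Π_a` is left-invariant. Hence `(id ⊗ Φ)(Δ ψ) = 1 ⊗ Φ ψ`, and applying `id ⊗ Φ⁻¹`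
shows that `Δ ψ - 1 ⊗ ψ` lies in `HR ⊗ 1`; the counit identifies it as `ψ ⊗ 1`
(`isPrimitive_of_D_eq`). For the derivations `ε ∘ ∂/∂φ^T` along the counit `ε` the value is that on
`a`, so `ψ` and `a` have the same linear part (`homogeneousComponent_one_of_D_eq`).
-/

namespace HR

open PlaneTree KaehlerDifferential

/-! ### Convolution -/

/-- The convolution product `a ↦ f(a₍₁₎) g(a₍₂₎)` of two linear maps from `HR` to an algebra. -/
noncomputable def conv {B : Type} [CommRing B] [Algebra ℂ B] (f g : HR →ₗ[ℂ] B) : HR →ₗ[ℂ] B :=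
  LinearMap.mul' ℂ B ∘ₗ TensorProduct.map f g ∘ₗ comulHom.toLinearMap

section conv

variable {B B' : Type} [CommRing B] [Algebra ℂ B] [CommRing B'] [Algebra ℂ B']

-- The laws of the convolution product are those of Mathlib's `WithConv`, for the coalgebra
-- structure of `hopfAlgebra` instead of the standard one on polynomials.
theorem conv_assoc (f g h : HR →ₗ[ℂ] B) : conv (conv f g) h = conv f (conv g h) := by
  let _ : Coalgebra ℂ HR := hopfAlgebra.toCoalgebra
  have key := mul_assoc (WithConv.toConv f) (WithConv.toConv g) (WithConv.toConv h)
  exact congrArg WithConv.ofConv key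

/-- The unit `a ↦ ε(a) 1` of the convolution product. -/
noncomputable def convOne (B : Type) [CommRing B] [Algebra ℂ B] : HR →ₗ[ℂ] B :=
  Algebra.linearMap ℂ B ∘ₗ counitHom.toLinearMap

theorem convOne_conv (f : HR →ₗ[ℂ] B) : conv (convOne B) f = f := by
  let _ : Coalgebra ℂ HR := hopfAlgebra.toCoalgebra
  have h := one_mul (WithConv.toConv f)
  exact congrArg WithConv.ofConv h

theorem algHom_comp_conv (φ : B →ₐ[ℂ] B') (f g : HR →ₗ[ℂ] B) :
    φ.toLinearMap ∘ₗ conv f g = conv (φ.toLinearMap ∘ₗ f) (φ.toLinearMap ∘ₗ g) := by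
  let _ : Coalgebra ℂ HR := hopfAlgebra.toCoalgebra
  exact LinearMap.algHom_comp_convMul_distrib φ (WithConv.toConv f) (WithConv.toConv g)

theorem algHom_comp_convOne (φ : B →ₐ[ℂ] B') : φ.toLinearMap ∘ₗ convOne B = convOne B' := by
  ext; simp [convOne]

theorem antipode_conv_id : conv antipodeHom.toLinearMap .id = convOne HR :=
  congrArg AlgHom.toLinearMap antipode_mul_id

theorem id_conv_antipode : conv .id antipodeHom.toLinearMap = convOne HR :=
  congrArg AlgHom.toLinearMap id_mul_antipode

open Algebra.TensorProduct in
/-- The identity `Δ(S(a₍₁₎)) (id ⊗ f)(Δ a₍₂₎) = 1 ⊗ S(a₍₁₎) f(a₍₂₎)`. It holds because `(id ⊗ f) ∘ Δ`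
is the convolution product of `Δ` with `1 ⊗ (S * f)`, and `Δ ∘ S` is the convolution inverse
of `Δ`. -/
theorem antipode_conv_lTensor (f : HR →ₗ[ℂ] HR) :
    conv (comulHom.toLinearMap ∘ₗ antipodeHom.toLinearMap)
        (f.lTensor HR ∘ₗ comulHom.toLinearMap) =
      (includeRight (R := ℂ) (A := HR) (B := HR)).toLinearMap ∘ₗ
        conv antipodeHom.toLinearMap f := by
  set i₁ : HR →ₐ[ℂ] HR ⊗[ℂ] HR := includeLeft
  set i₂ : HR →ₐ[ℂ] HR ⊗[ℂ] HR := includeRight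
  have h₁ (g : HR →ₗ[ℂ] HR) : g.lTensor HR ∘ₗ comulHom.toLinearMap =
      conv i₁.toLinearMap (i₂.toLinearMap ∘ₗ g) := by
    rw [conv, ← LinearMap.comp_assoc]
    congr 1
    ext
    simp [i₁, i₂]
  have h₂ : comulHom.toLinearMap = conv i₁.toLinearMap i₂.toLinearMap := by
    simpa using h₁ .id
  have h₃ : f = conv .id (conv antipodeHom.toLinearMap f) := by
    rw [← conv_assoc, id_conv_antipode, convOne_conv]
  have h₄ : f.lTensor HR ∘ₗ comulHom.toLinearMap = conv comulHom.toLinearMap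
      (i₂.toLinearMap ∘ₗ conv antipodeHom.toLinearMap f) := by
    rw [h₁, h₂, conv_assoc]
    conv_lhs => rw [h₃, algHom_comp_conv]
    rfl
  have h₅ : conv (comulHom.toLinearMap ∘ₗ antipodeHom.toLinearMap) comulHom.toLinearMap =
      convOne (HR ⊗[ℂ] HR) := by
    rw [← algHom_comp_convOne comulHom, ← antipode_conv_id, algHom_comp_conv]
    rfl
  rw [h₄, ← conv_assoc, h₅, convOne_conv]

end conv

/-! ### The counit and linear combinations of generators -/

theorem counitHom_eq_constantCoeff (a : HR) : counitHom a = MvPolynomial.constantCoeff a := by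
  rw [counitHom, MvPolynomial.aeval_zero]; rfl

theorem counitHom_antipodeHom (a : HR) : counitHom (antipodeHom a) = counitHom a := by
  suffices h : counitHom.comp antipodeHom = counitHom from AlgHom.congr_fun h a
  refine MvPolynomial.algHom_ext fun T => ?_
  obtain ⟨t, ht⟩ := exists_eq_gen T
  rw [ht, AlgHom.comp_apply, antipodeHom_gen, counitHom_gen]
  cases t with
  | node n f =>
    rw [antipodeTree, map_neg, neg_eq_zero]
    generalize ∏ i, antipodeAux (f i) = y
    induction y using TensorProduct.induction_on with
    | zero => simp
    | add y z hy hz => simp only [map_add, hy, hz, add_zero]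
    | tmul a b => simp [counitHom_joinRoot]

/-- Linear maps that agree on the generators agree on their linear combinations. -/
theorem eq_of_mem_linearSpan {M : Type} [AddCommMonoid M] [Module ℂ M] {f g : HR →ₗ[ℂ] M}
    (h : ∀ t, f (gen t) = g (gen t)) {a : HR} (ha : a ∈ linearSpan) : f a = g a := by
  refine LinearMap.eqOn_span (s := Set.range MvPolynomial.X) ?_ ha
  rintro _ ⟨T, rfl⟩
  obtain ⟨t, ht⟩ := exists_eq_gen T
  exact ht ▸ h t

theorem counitHom_eq_zero_of_mem_linearSpan {a : HR} (ha : a ∈ linearSpan) : counitHom a = 0 :=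
  eq_of_mem_linearSpan (f := counitHom.toLinearMap) (g := 0) counitHom_gen ha

/-! ### The polynomial degree operator -/

theorem pDegree_X (T : RTree) : pDegree (MvPolynomial.X T) = MvPolynomial.X T := by
  rw [MvPolynomial.X, pDegree_monomial]; simp

theorem pDegree_one : pDegree 1 = 0 := by
  rw [← MvPolynomial.C_1, MvPolynomial.C_apply, pDegree_monomial]; simp

theorem counitHom_pDegreeInv (a : HR) : counitHom (pDegreeInv a) = 0 := by
  classical
  rw [counitHom_eq_constantCoeff]
  induction a using MvPolynomial.induction_on' with
  | monomial m c =>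
    rw [pDegreeInv_monomial, MvPolynomial.constantCoeff_monomial]
    split_ifs with hm
    · simp [hm]
    · rfl
  | add p q hp hq => rw [map_add, map_add, hp, hq, add_zero]

theorem coeff_pDegree (m : RTree →₀ ℕ) (a : HR) :
    MvPolynomial.coeff m (pDegree a) = m.degree * MvPolynomial.coeff m a := by
  classical
  induction a using MvPolynomial.induction_on' with
  | monomial n c =>
    rw [pDegree_monomial, MvPolynomial.coeff_monomial, MvPolynomial.coeff_monomial]
    split_ifs with h
    · rw [h]
    · rw [mul_zero]
  | add p q hp hq => rw [map_add, MvPolynomial.coeff_add, MvPolynomial.coeff_add, hp, hq, mul_add]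

theorem pDegree_mul (a b : HR) : pDegree (a * b) = a * pDegree b + b * pDegree a := by
  induction a using MvPolynomial.induction_on' with
  | add p q hp hq => simp only [add_mul, map_add, hp, hq, mul_add]; ring
  | monomial m c =>
    induction b using MvPolynomial.induction_on' with
    | add p q hp hq => simp only [add_mul, map_add, hp, hq, mul_add]; ring
    | monomial n e =>
      simp only [pDegree_monomial, MvPolynomial.monomial_mul]
      rw [add_comm n m, ← (MvPolynomial.monomial (m + n)).map_add]
      congr 1
      rw [map_add Finsupp.degree]
      push_cast
      ring

/-- The Euler derivation `∑ φ^T ∂/∂φ^T`, which is the polynomial degree operator. -/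
noncomputable def euler : Derivation ℂ HR HR :=
  Derivation.mk' pDegree pDegree_mul

theorem euler_apply (a : HR) : euler a = pDegree a := rfl

/-- The commutator of `∂/∂φ^T` and the Euler derivation is `∂/∂φ^T`. -/
theorem pderiv_pDegree (T : RTree) (a : HR) : MvPolynomial.pderiv T (pDegree a) =
    pDegree (MvPolynomial.pderiv T a) + MvPolynomial.pderiv T a := by
  classical
  have h : ⁅(MvPolynomial.pderiv T : Derivation ℂ HR HR), euler⁆ = MvPolynomial.pderiv T := by
    refine MvPolynomial.derivation_ext fun U => ?_
    rw [Derivation.commutator_apply, euler_apply, euler_apply, pDegree_X, MvPolynomial.pderiv_X]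
    by_cases hU : U = T
    · subst hU; simp [pDegree_one]
    · simp [hU]
  have := Derivation.congr_fun h a
  rw [Derivation.commutator_apply, euler_apply, euler_apply] at this
  rw [← sub_eq_iff_eq_add', this]

theorem pDegree_add_self_injective : Function.Injective fun a : HR => pDegree a + a := by
  intro a b hab
  ext m
  have := congrArg (MvPolynomial.coeff m) hab
  simp only [MvPolynomial.coeff_add, coeff_pDegree] at this
  have h : ((m.degree : ℂ) + 1) ≠ 0 := Nat.cast_add_one_ne_zero _
  refine mul_left_cancel₀ h ?_
  linear_combination this

theorem pDegree_joinRoot (a : HR) : pDegree (joinRoot a) = joinRoot a := by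
  suffices h : pDegree ∘ₗ joinRoot = joinRoot from LinearMap.congr_fun h a
  refine (MvPolynomial.basisMonomials RTree ℂ).ext fun m => ?_
  obtain ⟨l, hl⟩ := exists_list m
  rw [MvPolynomial.coe_basisMonomials]
  beta_reduce
  rw [hl, LinearMap.comp_apply, joinRoot_list]
  exact pDegree_X _

/-- Each term of `Δ(φ^T)` other than `φ^T ⊗ 1` has a single generator as its right factor, on which
`Φ` is the identity; so `S(a₍₁₎) Φ(a₍₂₎)` differs from `S(a₍₁₎) a₍₂₎ = 0` by `S(a)`. -/
theorem antipode_conv_pDegree {a : HR} (ha : a ∈ linearSpan) :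
    conv antipodeHom.toLinearMap pDegree a = -antipodeHom a := by
  refine eq_of_mem_linearSpan (g := -antipodeHom.toLinearMap) ?_ ha
  rintro ⟨n, f⟩
  have h₀ := LinearMap.congr_fun antipode_conv_id (gen (node n f))
  have h₁ : TensorProduct.map antipodeHom.toLinearMap pDegree
      (joinRoot.lTensor HR (∏ i, comulTree (f i))) =
      TensorProduct.map antipodeHom.toLinearMap .id
        (joinRoot.lTensor HR (∏ i, comulTree (f i))) := by
    generalize ∏ i, comulTree (f i) = y
    induction y using TensorProduct.induction_on with
    | zero => simp
    | add y z hy hz => simp only [map_add, hy, hz]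
    | tmul a b => simp [pDegree_joinRoot]
  simp only [conv, convOne, LinearMap.comp_apply, AlgHom.toLinearMap_apply, comulHom_gen,
    comulTree_node, map_add, TensorProduct.map_tmul, h₁, pDegree_one, counitHom_gen, map_zero,
    LinearMap.id_apply, LinearMap.mul'_apply, mul_one, mul_zero, zero_add] at h₀ ⊢
  exact eq_neg_of_add_eq_zero_right h₀

/-! ### Differential forms -/

theorem liftKaehlerDifferential_leftInvariantForm {B : Type} [CommRing B] [Algebra ℂ B]
    [Algebra HR B] [IsScalarTower ℂ HR B] (L : Derivation ℂ HR B) (a : HR) :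
    L.liftKaehlerDifferential (leftInvariantForm a) =
      conv ((IsScalarTower.toAlgHom ℂ HR B).toLinearMap ∘ₗ antipodeHom.toLinearMap) L a := by
  rw [leftInvariantForm, conv, LinearMap.comp_apply, LinearMap.comp_apply,
    AlgHom.toLinearMap_apply]
  generalize comulHom a = y
  induction y using TensorProduct.induction_on with
  | zero => simp
  | add y z hy hz => simp only [map_add, hy, hz]
  | tmul b c =>
    change L.liftKaehlerDifferential (antipodeHom b • D ℂ HR c) = _
    rw [map_smul, Derivation.liftKaehlerDifferential_comp_D, Algebra.smul_def]
    rfl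

/-- If `dψ = Π_a`, then every derivation along an algebra homomorphism `φ` takes on `ψ` the value
that is read off from `Π_a = S(a₍₁₎) da₍₂₎`. -/
theorem apply_eq_conv_of_D_eq {B : Type} [CommRing B] [Algebra ℂ B] (φ : HR →ₐ[ℂ] B)
    (F : HR →ₗ[ℂ] B) (hF : ∀ x y, F (x * y) = φ x * F y + φ y * F x) {ψ a : HR}
    (h : D ℂ HR ψ = leftInvariantForm a) :
    F ψ = conv (φ.toLinearMap ∘ₗ antipodeHom.toLinearMap) F a := by
  -- `B` as an `HR`-module through `φ`, so that `F` extends to the 1-forms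
  let _ : Algebra HR B := φ.toRingHom.toAlgebra
  have : IsScalarTower ℂ HR B := IsScalarTower.of_algebraMap_eq fun c => (φ.commutes c).symm
  let L : Derivation ℂ HR B := Derivation.mk' F hF
  have hL := liftKaehlerDifferential_leftInvariantForm L a
  rw [← h, Derivation.liftKaehlerDifferential_comp_D] at hL
  exact hL

/-- The contraction of a 1-form with the Euler vector field, `∑ ω_T dφ^T ↦ ∑ ω_T φ^T`. -/
noncomputable def contractEuler : Ω[HR⁄ℂ] →ₗ[HR] HR := euler.liftKaehlerDifferential

theorem contractEuler_D (a : HR) : contractEuler (D ℂ HR a) = pDegree a :=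
  Derivation.liftKaehlerDifferential_comp_D euler a

theorem contractEuler_leftInvariantForm (a : HR) :
    contractEuler (leftInvariantForm a) = conv antipodeHom.toLinearMap pDegree a :=
  liftKaehlerDifferential_leftInvariantForm euler a

/-- Cartan's formula for the Euler field `E` and a closed 1-form `ω = ∑ ω_T dφ^T`: the equation
`d(i_E ω) = L_E ω`, read off at `dφ^T`. -/
theorem pderiv_contractEuler {ω : Ω[HR⁄ℂ]} (hω : extDeriv ω = 0) (T : RTree) :
    MvPolynomial.pderiv T (contractEuler ω) =
      pDegree ((mvPolynomialBasis ℂ RTree).repr ω T) + (mvPolynomialBasis ℂ RTree).repr ω T := by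
  classical
  let b := mvPolynomialBasis ℂ RTree
  change _ = pDegree (b.repr ω T) + b.repr ω T
  -- the contraction of 2-forms with `E` and `∂/∂φ^T`
  let c : ⋀[HR]^2 Ω[HR⁄ℂ] →ₗ[HR] HR := exteriorPower.alternatingMapLinearEquiv
    (Matrix.detRowAlternating.compLinearMap (LinearMap.pi ![contractEuler, b.coord T]))
  have hc (x y : HR) : c (exteriorPower.ιMulti HR 2 ![D ℂ HR x, D ℂ HR y]) =
      pDegree x * MvPolynomial.pderiv T y - MvPolynomial.pderiv T x * pDegree y := by
    rw [exteriorPower.alternatingMapLinearEquiv_apply_ιMulti]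
    refine (Matrix.det_fin_two _).trans ?_
    simp [contractEuler_D, b]
  have h₀ := congrArg c hω
  rw [extDeriv, map_zero, map_finsuppSum] at h₀
  simp only [hc, pDegree_X] at h₀
  have h₁ : contractEuler ω = (b.repr ω).sum fun U x => x * MvPolynomial.X U := by
    conv_lhs => rw [← b.linearCombination_repr ω, Finsupp.linearCombination_apply]
    rw [map_finsuppSum]
    refine Finsupp.sum_congr fun U _ => ?_
    rw [map_smul, mvPolynomialBasis_apply, contractEuler_D, pDegree_X, smul_eq_mul]
  have h₂ (f : HR →ₗ[ℂ] HR) : (b.repr ω).sum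
      (fun U x => f x * MvPolynomial.pderiv T (MvPolynomial.X U)) = f (b.repr ω T) := by
    rw [Finsupp.sum_eq_single T]
    · simp
    · intro U _ hU; simp [hU]
    · simp
  rw [h₁, map_finsuppSum]
  simp only [Derivation.leibniz, smul_eq_mul]
  have h₃ : (b.repr ω).sum (fun U x => pDegree x * MvPolynomial.pderiv T (MvPolynomial.X U)) =
      (b.repr ω).sum fun U x => MvPolynomial.pderiv T x * MvPolynomial.X U := by
    rw [← sub_eq_zero, ← h₀, Finsupp.sum, Finsupp.sum, ← Finset.sum_sub_distrib]
    rfl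
  rw [Finsupp.sum_add, ← h₂ pDegree, h₃, add_comm]
  simp only [mul_comm (MvPolynomial.X _)]
  exact congrArg _ (h₂ .id)

/-- The Poincaré lemma for polynomial 1-forms: a potential of a closed form `ω` is any `ψ` with
`Φ ψ = i_E ω`. -/
theorem D_eq_of_closed {ω : Ω[HR⁄ℂ]} (hω : extDeriv ω = 0) {ψ : HR}
    (hψ : pDegree ψ = contractEuler ω) : D ℂ HR ψ = ω := by
  refine (mvPolynomialBasis ℂ RTree).ext_elem fun T => ?_
  refine pDegree_add_self_injective ?_
  beta_reduce
  rw [← pderiv_contractEuler hω, ← hψ, pderiv_pDegree, mvPolynomialBasis_repr_apply]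

/-! ### Primitivity and the linear part -/

/-- A potential `ψ` of `Π_a`, without constant term and such that `Φ ψ = -S(a)`, is primitive:
left invariance of `Π_a` gives `(id ⊗ Φ)(Δ ψ) = 1 ⊗ Φ ψ`. -/
theorem isPrimitive_of_D_eq {ψ a : HR} (ha : a ∈ linearSpan)
    (hψ : pDegree ψ = -antipodeHom a) (hψ₀ : counitHom ψ = 0)
    (h : D ℂ HR ψ = leftInvariantForm a) : IsPrimitive ψ := by
  have hF (x y : HR) : (pDegree.lTensor HR ∘ₗ comulHom.toLinearMap) (x * y) =
      comulHom x * (pDegree.lTensor HR ∘ₗ comulHom.toLinearMap) y +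
        comulHom y * (pDegree.lTensor HR ∘ₗ comulHom.toLinearMap) x := by
    simp only [LinearMap.comp_apply, AlgHom.toLinearMap_apply, map_mul]
    generalize comulHom x = u
    generalize comulHom y = v
    induction u using TensorProduct.induction_on with
    | zero => simp
    | add u u' hu hu' => simp only [add_mul, mul_add, map_add, hu, hu']; ring
    | tmul a b =>
      induction v using TensorProduct.induction_on with
      | zero => simp
      | add v v' hv hv' => simp only [add_mul, mul_add, map_add, hv, hv']; ring
      | tmul c d =>
        simp [pDegree_mul, TensorProduct.tmul_add, mul_comm c a]
  have h₁ := apply_eq_conv_of_D_eq comulHom _ hF h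
  rw [antipode_conv_lTensor, LinearMap.comp_apply, LinearMap.comp_apply,
    antipode_conv_pDegree ha, ← hψ] at h₁
  -- `Φ⁻¹ ∘ Φ` removes the constant term, so `id ⊗ (Φ⁻¹ ∘ Φ)` subtracts `id ⊗ ε`
  have h₂ (y : HR ⊗[ℂ] HR) : pDegreeInv.lTensor HR (pDegree.lTensor HR y) =
      y - Algebra.TensorProduct.rid ℂ ℂ HR
        (Algebra.TensorProduct.map (.id ℂ HR) counitHom y) ⊗ₜ[ℂ] 1 := by
    induction y using TensorProduct.induction_on with
    | zero => simp
    | add y z hy hz => simp only [map_add, hy, hz, TensorProduct.add_tmul]; abel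
    | tmul b c =>
      rw [LinearMap.lTensor_tmul, LinearMap.lTensor_tmul, pDegree_comm, pDegree_pDegreeInv,
        TensorProduct.tmul_sub, ← counitHom_eq_constantCoeff, MvPolynomial.C_eq_smul_one,
        TensorProduct.tmul_smul, TensorProduct.smul_tmul']
      simp
  have h₃ := congrArg (pDegreeInv.lTensor HR) h₁
  have h₄ := AlgHom.congr_fun lTensor_counit ψ
  simp only [AlgHom.comp_apply] at h₄
  change pDegreeInv.lTensor HR (pDegree.lTensor HR (comulHom ψ)) =
    pDegreeInv.lTensor HR (1 ⊗ₜ[ℂ] pDegree ψ) at h₃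
  rw [h₂, h₄, LinearMap.lTensor_tmul, pDegree_comm, pDegree_pDegreeInv,
    ← counitHom_eq_constantCoeff, hψ₀, map_zero, sub_zero, sub_eq_iff_eq_add] at h₃
  rw [IsPrimitive, h₃, add_comm]
  simp

/-- At the origin, where `S(a₍₁₎)` becomes `ε(a₍₁₎)`, the forms `dψ = Π_a` and `da` agree. -/
theorem counitHom_pderiv_of_D_eq {ψ a : HR} (h : D ℂ HR ψ = leftInvariantForm a) (T : RTree) :
    counitHom (MvPolynomial.pderiv T ψ) = counitHom (MvPolynomial.pderiv T a) := by
  let F : HR →ₗ[ℂ] ℂ := counitHom.toLinearMap ∘ₗ (MvPolynomial.pderiv T).toLinearMap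
  have hF (x y : HR) : F (x * y) = counitHom x * F y + counitHom y * F x := by
    simp [F]
  have hS : counitHom.toLinearMap ∘ₗ antipodeHom.toLinearMap = convOne ℂ :=
    LinearMap.ext counitHom_antipodeHom
  exact (apply_eq_conv_of_D_eq counitHom F hF h).trans (by rw [hS, convOne_conv]; rfl)

theorem homogeneousComponent_one_of_D_eq {ψ a : HR} (ha : a ∈ linearSpan)
    (h : D ℂ HR ψ = leftInvariantForm a) : MvPolynomial.homogeneousComponent 1 ψ = a := by
  classical
  have ha' : MvPolynomial.homogeneousComponent 1 a = a := by
    refine eq_of_mem_linearSpan (g := .id) (fun t => ?_) ha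
    exact (MvPolynomial.homogeneousComponent_of_mem (MvPolynomial.isHomogeneous_X _ _)).trans
      (if_pos rfl)
  rw [← ha']
  ext m
  rw [MvPolynomial.coeff_homogeneousComponent, MvPolynomial.coeff_homogeneousComponent]
  split_ifs with hm
  · obtain ⟨T, rfl⟩ := (Finsupp.sum_eq_one_iff m).mp hm
    have := counitHom_pderiv_of_D_eq h T
    rw [counitHom_eq_constantCoeff, counitHom_eq_constantCoeff, MvPolynomial.constantCoeff_eq,
      MvPolynomial.coeff_pderiv, MvPolynomial.coeff_pderiv] at this
    simpa using this
  · rfl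

end HR

/-- If the left-invariant 1-form of a linear combination `φ'` of the generators is closed, then
`ψ' = -Φ⁻¹ (S φ')` is primitive and has `φ'` as its linear part. The first conjunct says that
`S φ'` is in the domain of `Φ⁻¹`. -/
theorem theorem2 (φ' : HR) (hφ' : φ' ∈ HR.linearSpan)
    (hclosed : HR.extDeriv (HR.leftInvariantForm φ') = 0) :
    HR.pDegree (-HR.pDegreeInv (HR.antipodeHom φ')) = -HR.antipodeHom φ' ∧
      HR.IsPrimitive (-HR.pDegreeInv (HR.antipodeHom φ')) ∧
      MvPolynomial.homogeneousComponent 1 (-HR.pDegreeInv (HR.antipodeHom φ')) = φ' := by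
  have h₀ : HR.pDegree (-HR.pDegreeInv (HR.antipodeHom φ')) = -HR.antipodeHom φ' := by
    rw [map_neg, HR.pDegree_pDegreeInv, ← HR.counitHom_eq_constantCoeff,
      HR.counitHom_antipodeHom, HR.counitHom_eq_zero_of_mem_linearSpan hφ', map_zero, sub_zero]
  have h₁ : HR.counitHom (-HR.pDegreeInv (HR.antipodeHom φ')) = 0 := by
    rw [map_neg, HR.counitHom_pDegreeInv, neg_zero]
  have h₂ : KaehlerDifferential.D ℂ HR (-HR.pDegreeInv (HR.antipodeHom φ')) =
      HR.leftInvariantForm φ' := by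
    refine HR.D_eq_of_closed hclosed ?_
    rw [HR.contractEuler_leftInvariantForm, HR.antipode_conv_pDegree hφ', h₀]
  exact ⟨h₀, HR.isPrimitive_of_D_eq hφ' h₀ h₁ h₂, HR.homogeneousComponent_one_of_D_eq hφ' h₂⟩
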